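/- \textbf{Model.} A game consists of finitely many agents $i$, finitely many resources $r$, a set of permissible actions $\mathcal A_i\subseteq 2^{\mathcal R}$ for each agent, a true value $y_r\ge 0$ of each resource, and each agent's own valuations $y_{i,r}\ge 0$. For an allocation $a=(a_i)_i$, $a_i\in\mathcal A_i$, let $|a|_r$ be the number of agents $i$ with $r\in a_i$. In a set covering game the welfare $W(a)=\sum_{r\in\bigcup_i a_i}y_r$ is the true value of the covered resources. Given a utility design $u:\mathbb N\to\mathbb R$ with $u(0)=0$, $u(1)=1$, agent $i$ has utility $U_i(a)=\sum_{r\in a_i}y_{i,r}\,u(|a|_r)$, and $a$ is an equilibrium if no agent can increase its utility by a unilateral change to another permissible action. For $0\le\delta<1$ let $\mathcal G^\delta_u$ be the class of all such games, with any finite number of agents, with uncertainty at most $\delta$, i.e. $|y_{i,r}-y_r|\le\delta\,y_r$ for all $i,r$, that have an equilibrium and an allocation of positive welfare. The price of anarchy of a game is the minimum of $W$ over its equilibria divided by the maximum of $W$ over its allocations, and $\mathrm{PoA}(\mathcal G^\delta_u)$ is the infimum of the price of anarchy over the class. Let $\mathcal G^{\delta}_{u,n}$ be the subclass of games with at most $n$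 agents, and $B=\frac{1+\delta}{1-\delta}$. \textbf{Theorem.} Let $0\le\delta<1$. The design given by $u^{\rm opt}(0)=0$ and the convergent series $$u^{\rm opt}(j)=\sum_{k=j}^{\infty}\frac{(j-1)!}{B^{k-j+1}\,(e^{1/B}-1)\,k!}\qquad(j\ge 1)$$ satisfies $u^{\rm opt}(1)=1$ and is the optimal utility design: $\mathrm{PoA}(\mathcal G^\delta_u)\le\mathrm{PoA}(\mathcal G^\delta_{u^{\rm opt}})$ for every design $u$ with $u(0)=0$, $u(1)=1$, with equality only for $u=u^{\rm opt}$. The corresponding price of anarchy is $$\mathrm{PoA}(\mathcal G^\delta_{u^{\rm opt}})=1-e^{-1/B},$$ and this is also the limit, as $n\to\infty$, both of $\mathrm{PoA}(\mathcal G^\delta_{u^{\rm opt},n})$ and of $\sup_u\mathrm{PoA}(\mathcal G^\delta_{u,n})$. -/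

import Mathlib

open Filter Topology
open scoped Nat

namespace CoveringUncertainty

/-- The data of a resource allocation game with linear resource states, apart from the two
functions `w` (welfare) and `u` (utility) that are common to all resources: finitely many agents
and resources, a set of permissible actions (sets of resources) for each agent, the true state
`trueState r ≥ 0` of each resource, and each agent's own valuation `belief i r ≥ 0` of it. -/
structure Game where
  /-- the number of agents -/
  agents : ℕ
  /-- the number of resources -/
  resources : ℕ
  /-- the permissible actions of each agent -/
  actions : Fin agents → Finset (Finset (Fin resources))
  /-- the true state of each resource -/
  trueState : Fin resources → ℝ
  /-- the state of each resource according to each agent -/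
  belief : Fin agents → Fin resources → ℝ
  trueState_nonneg : ∀ r, 0 ≤ trueState r
  belief_nonneg : ∀ i r, 0 ≤ belief i r

namespace Game

variable (G : Game)

/-- A choice of one set of resources for each agent. -/
abbrev Profile : Type := Fin G.agents → Finset (Fin G.resources)

/-- The admissible joint allocations: every agent plays a permissible action. -/
def allocations : Set G.Profile := {a | ∀ i, a i ∈ G.actions i}

/-- The number of agents that select the resource `r` in the profile `a`. -/
def load (a : G.Profile) (r : Fin G.resources) : ℕ :=
  (Finset.univ.filter fun i => r ∈ a i).card

/-- The system welfare, evaluated at the true state. -/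
noncomputable def welfare (w : ℕ → ℝ) (a : G.Profile) : ℝ :=
  ∑ r, G.trueState r * w (G.load a r)

/-- The utility of agent `i`, evaluated at the agent's own valuation of the resources. -/
noncomputable def utility (u : ℕ → ℝ) (i : Fin G.agents) (a : G.Profile) : ℝ :=
  ∑ r ∈ a i, G.belief i r * u (G.load a r)

/-- The (pure Nash) equilibria, every agent judging by its own valuation. -/
def equilibria (u : ℕ → ℝ) : Set G.Profile :=
  {a | a ∈ G.allocations ∧ ∀ i, ∀ s ∈ G.actions i,
    G.utility u i (Function.update a i s) ≤ G.utility u i a}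

/-- Every agent's valuation of every resource has relative error at most `δ`.
(The error bound is multiplied out, so that a resource of true value `0` is valued at `0`.) -/
def UncertaintyLE (δ : ℝ) : Prop :=
  ∀ i r, |G.belief i r - G.trueState r| ≤ δ * G.trueState r

/-- The price of anarchy of one game: the worst equilibrium welfare over the best welfare. Both
sets of values are finite, so infimum and supremum are a minimum and a maximum whenever there
is an equilibrium. -/
noncomputable def poa (w u : ℕ → ℝ) : ℝ :=
  sInf (G.welfare w '' G.equilibria u) / sSup (G.welfare w '' G.allocations)

end Game

/-- The class of games with at most `N` agents (`N = ⊤`: any finite number of agents), welfare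
function `w`, utility function `u` and uncertainty at most `δ`. The games have an
equilibrium, and some allocation has positive welfare, so that the ratio that defines the price
of anarchy makes sense. -/
def gameClass (N : ℕ∞) (w u : ℕ → ℝ) (δ : ℝ) : Set Game :=
  {G | (G.agents : ℕ∞) ≤ N ∧ G.UncertaintyLE δ ∧ (G.equilibria u).Nonempty ∧
    ∃ a ∈ G.allocations, 0 < G.welfare w a}

/-- The price of anarchy of a class of games: the infimum over its games. -/
noncomputable def classPoA (N : ℕ∞) (w u : ℕ → ℝ) (δ : ℝ) : ℝ :=
  sInf ((fun G : Game => G.poa w u) '' gameClass N w u δ)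

/-- The welfare function of set covering games: a resource counts once as soon as it is covered. -/
def coverWelfare (k : ℕ) : ℝ := if k = 0 then 0 else 1

/-- The utility functions a designer may choose: `u 0 = 0` and, as a normalization, `u 1 = 1`. -/
def IsUtilityDesign (u : ℕ → ℝ) : Prop := u 0 = 0 ∧ u 1 = 1

/-- The constant `B = (1 + δ) / (1 - δ)`. -/
noncomputable def ratioB (δ : ℝ) : ℝ := (1 + δ) / (1 - δ)

/-- The `k`-th term, for `k ≥ j ≥ 1`, of the series that defines the optimal utility design. -/
noncomputable def optTerm (δ : ℝ) (j k : ℕ) : ℝ :=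
  ((j - 1)! : ℝ) / (ratioB δ ^ (k - j + 1) * (Real.exp (1 / ratioB δ) - 1) * (k ! : ℝ))

/-- The optimal utility design. -/
noncomputable def optUtility (δ : ℝ) (j : ℕ) : ℝ :=
  if j = 0 then 0 else ∑' k : Set.Ici j, optTerm δ j k

end CoveringUncertainty

/-! Write p for the price of anarchy of a design `u`, and q for 1 - exp(-1/B). Two families of games
bound p from above: p(1 + B k u(k) - u(k+1)) ≤ 1 (`classPoA_mul_le_of_succ_le`) and p B k u(k) ≤ 1
(`classPoA_mul_le_of_le`). The first is a recurrence forcing p u(n+1) to be at least n! Bⁿ (1 -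
(1-p) Sₙ), where Sₙ is a partial sum of exp(1/B); the second forces p u(n+1) to tend to 0. Both hold
for large n only if 1 - (1-p) exp(1/B) ≤ 0 in the limit, that is p ≤ q.

The optimal design makes the first family tight: u(k+1) = B k u(k) - (1/q - 1), solved by
factorially weighted tails of the exponential series. It is nonnegative and nonincreasing from 1 on,
so a smoothness inequality holds resource by resource (`coverWelfare_le_of_recurrence`). Summed with
the equilibrium conditions, it gives p ≥ q.

Uniqueness: if `u` also attains q, its excess d over the optimal design satisfies d(k+1) ≥ B k d(k)
and d(1) = 0. So d ≥ 0, and a positive value would make k d(k) unbounded, against the second family.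
-/

namespace CoveringUncertainty

/-! ### Unilateral deviations and the price of anarchy of a single game -/

namespace Game

variable (G : Game)

lemma load_eq_add_card_erase (a : G.Profile) (i : Fin G.agents) (r : Fin G.resources) :
    G.load a r =
      (if r ∈ a i then 1 else 0) + ((Finset.univ.erase i).filter fun j => r ∈ a j).card := by
  unfold load
  rw [Finset.card_filter, Finset.card_filter, 
    Finset.add_sum_erase _ (fun j => if r ∈ a j then 1 else 0) (Finset.mem_univ i)]

/-- The other agents contribute equally to both loads. The additive form avoids truncated
subtraction. -/
lemma load_update (a : G.Profile) (i : Fin G.agents) (s : Finset (Fin G.resources))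
    (r : Fin G.resources) :
    G.load (Function.update a i s) r + (if r ∈ a i then 1 else 0) =
      G.load a r + (if r ∈ s then 1 else 0) := by
  rw [G.load_eq_add_card_erase a i, G.load_eq_add_card_erase _ i, Function.update_self]
  have h : ((Finset.univ.erase i).filter fun j => r ∈ Function.update a i s j) =
      (Finset.univ.erase i).filter fun j => r ∈ a j := by
    refine Finset.filter_congr fun j hj => ?_
    rw [Function.update_of_ne (Finset.ne_of_mem_erase hj)]
  rw [h]
  ring

/-- The loss of an agent that deviates, resource by resource. -/
lemma utility_sub_utility_update (u : ℕ → ℝ) (a : G.Profile) (i : Fin G.agents)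
    (s : Finset (Fin G.resources)) :
    G.utility u i a - G.utility u i (Function.update a i s) =
      ∑ r, G.belief i r * ((if r ∈ a i ∧ r ∉ s then u (G.load a r) else 0) -
        (if r ∈ s ∧ r ∉ a i then u (G.load a r + 1) else 0)) := by
  have h : ∀ t : Finset (Fin G.resources), ∀ f : Fin G.resources → ℝ,
      ∑ r ∈ t, f r = ∑ r, if r ∈ t then f r else 0 := fun t f => by
    rw [Finset.sum_ite_mem, Finset.univ_inter]
  unfold utility
  rw [Function.update_self, h (a i), h s, ← Finset.sum_sub_distrib]
  refine Finset.sum_congr rfl fun r _ => ?_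
  have hl := G.load_update a i s r
  by_cases h1 : r ∈ a i <;> by_cases h2 : r ∈ s <;> simp only [h1, h2, if_true, if_false] at hl
  · rw [Nat.add_right_cancel hl]
    simp [h1, h2]
  · simp [h1, h2]
  · rw [← hl]
    simp [h1, h2]
  · simp [h1, h2]

lemma welfare_nonneg (a : G.Profile) : 0 ≤ G.welfare coverWelfare a :=
  Finset.sum_nonneg fun r _ => mul_nonneg (G.trueState_nonneg r) <| by
    unfold coverWelfare; split_ifs <;> norm_num

lemma poa_nonneg (u : ℕ → ℝ) : 0 ≤ G.poa coverWelfare u := by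
  refine div_nonneg (Real.sInf_nonneg ?_) (Real.sSup_nonneg ?_) <;>
  · rintro _ ⟨a, -, rfl⟩
    exact G.welfare_nonneg a

lemma poa_le_div {u : ℕ → ℝ} {a b : G.Profile} (ha : a ∈ G.equilibria u)
    (hb : b ∈ G.allocations) (hb0 : 0 < G.welfare coverWelfare b) :
    G.poa coverWelfare u ≤ G.welfare coverWelfare a / G.welfare coverWelfare b :=
  div_le_div₀ (G.welfare_nonneg a)
    (csInf_le (Set.toFinite _).bddBelow (Set.mem_image_of_mem _ ha)) hb0
    (le_csSup (Set.toFinite _).bddAbove (Set.mem_image_of_mem _ hb))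

lemma le_poa {u : ℕ → ℝ} {q : ℝ} (hq : 0 < q) (he : (G.equilibria u).Nonempty)
    (hpos : ∃ a ∈ G.allocations, 0 < G.welfare coverWelfare a)
    (h : ∀ a ∈ G.equilibria u, ∀ b ∈ G.allocations,
      q * G.welfare coverWelfare b ≤ G.welfare coverWelfare a) :
    q ≤ G.poa coverWelfare u := by
  obtain ⟨b₀, hb₀, hb₀pos⟩ := hpos
  have hS : 0 < sSup (G.welfare coverWelfare '' G.allocations) :=
    hb₀pos.trans_le (le_csSup (Set.toFinite _).bddAbove (Set.mem_image_of_mem _ hb₀))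
  unfold poa
  rw [le_div_iff₀ hS]
  refine le_csInf (he.image _) ?_
  rintro _ ⟨a, ha, rfl⟩
  rw [mul_comm, ← le_div_iff₀ hq]
  refine csSup_le ⟨_, Set.mem_image_of_mem _ hb₀⟩ ?_
  rintro _ ⟨b, hb, rfl⟩
  rw [le_div_iff₀ hq, mul_comm]
  exact h a ha b hb

/-- The equilibrium conditions of all agents, added up and estimated with the uncertainty. -/
lemma sum_deviation_nonneg {δ : ℝ} (hδ : G.UncertaintyLE δ) {u : ℕ → ℝ} (hu : ∀ k, 0 ≤ u k)
    {a b : G.Profile} (ha : a ∈ G.equilibria u) (hb : b ∈ G.allocations) :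
    0 ≤ ∑ r, G.trueState r *
      ((1 + δ) * ((Finset.univ.filter fun i => r ∈ a i ∧ r ∉ b i).card * u (G.load a r)) -
        (1 - δ) * ((Finset.univ.filter fun i => r ∈ b i ∧ r ∉ a i).card *
          u (G.load a r + 1))) := by
  have h1 : 0 ≤ ∑ i, (G.utility u i a - G.utility u i (Function.update a i (b i))) :=
    Finset.sum_nonneg fun i _ => sub_nonneg.2 (ha.2 i _ (hb i))
  refine h1.trans ?_
  simp only [G.utility_sub_utility_update]
  rw [Finset.sum_comm]
  refine Finset.sum_le_sum fun r _ => ?_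
  rw [Finset.card_filter, Finset.card_filter]
  push_cast
  rw [Finset.sum_mul, Finset.sum_mul, Finset.mul_sum, Finset.mul_sum,
    ← Finset.sum_sub_distrib, Finset.mul_sum]
  refine Finset.sum_le_sum fun i _ => ?_
  have h2 := abs_le.1 (hδ i r)
  have h3 := hu (G.load a r)
  have h4 := hu (G.load a r + 1)
  by_cases hra : r ∈ a i <;> by_cases hrb : r ∈ b i <;> simp [hra, hrb] <;> nlinarith

end Game

/-! ### Worst-case games: upper bounds for an arbitrary design -/

lemma classPoA_nonneg (N : ℕ∞) (u : ℕ → ℝ) (δ : ℝ) : 0 ≤ classPoA N coverWelfare u δ :=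
  Real.sInf_nonneg <| by
    rintro _ ⟨G, -, rfl⟩
    exact G.poa_nonneg u

/-- A game in which every agent overestimates the resources of one profile `e` and underestimates
the others: if the agents then have no incentive to move to the profile `o`, the price of anarchy
is at most the ratio of the two welfares. -/
lemma classPoA_le_of_profiles {δ : ℝ} (hδ0 : 0 ≤ δ) (hδ1 : δ < 1) {u : ℕ → ℝ} {N : ℕ∞}
    {n m : ℕ} (hn : (n : ℕ∞) ≤ N) (y : Fin m → ℝ) (hy : ∀ r, 0 ≤ y r)
    (e o : Fin n → Finset (Fin m)) (l : Fin m → ℕ)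
    (hl : ∀ r, (Finset.univ.filter fun i => r ∈ e i).card = l r)
    (h : ∀ i, (1 - δ) * ∑ r, (if r ∈ o i ∧ r ∉ e i then y r * u (l r + 1) else 0) ≤
      (1 + δ) * ∑ r, (if r ∈ e i ∧ r ∉ o i then y r * u (l r) else 0))
    {α β : ℝ} (hα : ∑ r, y r * coverWelfare (l r) = α)
    (hβ : ∑ r, y r * coverWelfare (Finset.univ.filter fun i => r ∈ o i).card = β)
    (hβ0 : 0 < β) :
    classPoA N coverWelfare u δ ≤ α / β := by
  let G : Game :=
    { agents := n
      resources := m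
      actions := fun i => {e i, o i}
      trueState := y
      belief := fun i r => (if r ∈ e i then 1 + δ else 1 - δ) * y r
      trueState_nonneg := hy
      belief_nonneg := fun i r => mul_nonneg (by split_ifs <;> linarith) (hy r) }
  have hload : ∀ r, G.load e r = l r := hl
  have he : e ∈ G.equilibria u := by
    refine ⟨fun i => Finset.mem_insert_self _ _, fun i s hs => sub_nonneg.1 ?_⟩
    rcases Finset.mem_insert.1 hs with rfl | hs
    · rw [Function.update_eq_self, sub_self]
    · rw [Finset.mem_singleton] at hs
      subst hs
      rw [G.utility_sub_utility_update]
      have := h i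
      rw [Finset.mul_sum, Finset.mul_sum, ← sub_nonneg, ← Finset.sum_sub_distrib] at this
      refine this.trans_eq (Finset.sum_congr rfl fun r _ => ?_)
      rw [hload]
      change _ = (if r ∈ e i then 1 + δ else 1 - δ) * y r * _
      by_cases h1 : r ∈ e i <;> by_cases h2 : r ∈ o i <;> simp [h1, h2, mul_assoc]
  have ho : o ∈ G.allocations := fun i =>
    Finset.mem_insert_of_mem (Finset.mem_singleton_self _)
  have hWo : G.welfare coverWelfare o = β := hβ
  have hWe : G.welfare coverWelfare e = α := by
    rw [← hα]
    exact Finset.sum_congr rfl fun r _ => by rw [hload]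
  have hG : G ∈ gameClass N coverWelfare u δ := by
    refine ⟨hn, fun i r => ?_, ⟨e, he⟩, o, ho, hWo ▸ hβ0⟩
    change |(if r ∈ e i then 1 + δ else 1 - δ) * y r - y r| ≤ δ * y r
    have : 0 ≤ δ * y r := mul_nonneg hδ0 (hy r)
    split_ifs <;> rw [abs_le] <;> constructor <;> linarith
  have hle : classPoA N coverWelfare u δ ≤ G.poa coverWelfare u :=
    csInf_le ⟨0, by rintro _ ⟨H, -, rfl⟩; exact H.poa_nonneg u⟩ (Set.mem_image_of_mem _ hG)
  rw [← hWe, ← hWo]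
  exact hle.trans (G.poa_le_div he ho (hWo ▸ hβ0))

lemma one_le_ratioB {δ : ℝ} (hδ0 : 0 ≤ δ) (hδ1 : δ < 1) : 1 ≤ ratioB δ := by
  unfold ratioB
  rw [le_div_iff₀ (by linarith)]
  linarith

lemma one_sub_mul_ratioB {δ : ℝ} (hδ1 : δ < 1) : (1 - δ) * ratioB δ = 1 + δ :=
  mul_div_cancel₀ _ (by linarith)

lemma castAdd_ne_natAdd {m n : ℕ} (i : Fin m) (j : Fin n) : Fin.castAdd n i ≠ Fin.natAdd m j := by
  rw [Ne, Fin.ext_iff, Fin.val_castAdd, Fin.val_natAdd]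
  omega

/-- In the worst game, `k + 1` agents share `k + 1` resources, each of which is left out by exactly
one agent at the equilibrium; that agent covers it in the optimal allocation, together with a
resource of its own. -/
lemma classPoA_mul_le_of_succ_le {δ : ℝ} (hδ0 : 0 ≤ δ) (hδ1 : δ < 1) {u : ℕ → ℝ} {N : ℕ∞} {k : ℕ}
    (hu : u 1 = 1) (hk1 : 1 ≤ k) (hk : ((k + 1 : ℕ) : ℕ∞) ≤ N) (hp : classPoA N coverWelfare u δ ≤ 1) :
    classPoA N coverWelfare u δ * (1 + ratioB δ * k * u k - u (k + 1)) ≤ 1 := by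
  -- The value of the private resources that makes every agent exactly indifferent: (1-δ)(u(k+1) +
  -- v) = (1+δ) k u(k). A negative v is no legal value, but then the claim follows from p ≤ 1.
  obtain ⟨v, hv⟩ : ∃ v, v = ratioB δ * k * u k - u (k + 1) := ⟨_, rfl⟩
  rw [add_sub_assoc, ← hv]
  rcases lt_or_ge v 0 with hv0 | hv0
  · nlinarith [classPoA_nonneg N u δ]
  have hk0 : (0 : ℝ) < ((k + 1 : ℕ) : ℝ) := by positivity
  have key : classPoA N coverWelfare u δ ≤ ((k + 1 : ℕ) : ℝ) / ((k + 1 : ℕ) * (1 + v)) := by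
    obtain ⟨n, hn⟩ : ∃ n, n = k + 1 := ⟨_, rfl⟩
    rw [← hn] at hk hk0 ⊢
    refine classPoA_le_of_profiles hδ0 hδ1 hk (m := n + n)
      (Fin.append (fun _ => 1) (fun _ => v))
      (Fin.addCases (by simp) fun j => by rw [Fin.append_right]; exact hv0)
      (fun i => (Finset.univ.erase i).map (Fin.castAddEmb n))
      (fun i => {Fin.castAdd n i, Fin.natAdd n i})
      (Fin.append (fun _ => k) (fun _ => 0)) ?_ ?_ ?_ ?_ (by positivity)
    · refine Fin.addCases (fun j => ?_) (fun j => ?_)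
      · simp [Finset.filter_ne, hn]
      · simp [castAdd_ne_natAdd, -Fin.natAdd_eq_addNat]
    · intro i
      simp [Fin.sum_univ_add, castAdd_ne_natAdd, (castAdd_ne_natAdd _ _).symm, hu,
        -Fin.natAdd_eq_addNat]
      have hsum : ∑ x : Fin n, (if x = i then 0 else u k) = k * u k := by
        simp [Finset.sum_ite, Finset.filter_ne', hn]
      rw [hsum, hv, ← one_sub_mul_ratioB hδ1]
      linarith
    · simp [Fin.sum_univ_add, coverWelfare, -Fin.natAdd_eq_addNat]
      omega
    · simp [Fin.sum_univ_add, coverWelfare, castAdd_ne_natAdd,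
        (castAdd_ne_natAdd _ _).symm, -Fin.natAdd_eq_addNat]
      ring
  rw [div_mul_cancel_left₀ hk0.ne', ← one_div] at key
  rwa [← le_div_iff₀ (by linarith)]

/-- In the worst game, all agents share one resource at the equilibrium, and every agent covers a
resource of its own in the optimal allocation. -/
lemma classPoA_mul_le_of_le {δ : ℝ} (hδ0 : 0 ≤ δ) (hδ1 : δ < 1) {u : ℕ → ℝ} {N : ℕ∞} {k : ℕ}
    (hu : u 1 = 1) (hk : (k : ℕ∞) ≤ N) :
    classPoA N coverWelfare u δ * (ratioB δ * k * u k) ≤ 1 := by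
  -- Again the value of indifference: (1-δ) v = (1+δ) u(k).
  obtain ⟨v, hv⟩ : ∃ v, v = ratioB δ * u k := ⟨_, rfl⟩
  rw [show ratioB δ * k * u k = k * v by rw [hv]; ring]
  have hp := classPoA_nonneg N u δ
  rcases le_or_gt ((k : ℝ) * v) 0 with hv0 | hv0
  · nlinarith
  have hk0 : k ≠ 0 := by rintro rfl; simp at hv0
  have hv1 : 0 < v := pos_of_mul_pos_right hv0 (Nat.cast_nonneg k)
  rw [← le_div_iff₀ hv0]
  refine classPoA_le_of_profiles hδ0 hδ1 hk (m := 1 + k)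
    (Fin.append (fun _ => 1) (fun _ => v))
    (Fin.addCases (by simp) (by simp [hv1.le]))
    (fun i => {Fin.castAdd k 0}) (fun i => {Fin.natAdd 1 i})
    (Fin.append (fun _ => k) (fun _ => 0)) ?_ ?_ ?_ ?_ hv0
  · refine Fin.addCases (fun j => ?_) (fun j => ?_)
    · simp [Subsingleton.elim j 0]
    · simp
      exact fun h => absurd h.symm (castAdd_ne_natAdd _ _)
  · intro i
    simp [Fin.sum_univ_add, hu, castAdd_ne_natAdd, (castAdd_ne_natAdd _ _).symm]
    rw [hv, ← mul_assoc, one_sub_mul_ratioB hδ1]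
  · simp [Fin.sum_univ_add, coverWelfare]
    exact hk0
  · simp [Fin.sum_univ_add, coverWelfare, castAdd_ne_natAdd]

/-! ### The optimal design: closed form, recurrence, monotonicity -/

lemma one_lt_exp_one_div_ratioB {δ : ℝ} (hδ0 : 0 ≤ δ) (hδ1 : δ < 1) :
    1 < Real.exp (1 / ratioB δ) :=
  Real.one_lt_exp_iff.2 (by unfold ratioB; have : 0 < 1 - δ := by linarith
                            positivity)

lemma hasSum_pow_div_factorial_nat_add (x : ℝ) (j : ℕ) :
    HasSum (fun m : ℕ => x ^ (m + j) / (m + j)!)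
      (Real.exp x - ∑ k ∈ Finset.range j, x ^ k / k !) := by
  have h : HasSum (fun n : ℕ => x ^ n / n !) (Real.exp x) := by
    rw [Real.exp_eq_exp_ℝ]
    exact NormedSpace.expSeries_div_hasSum_exp x
  exact (hasSum_nat_add_iff' j).2 h

/-- The natural numbers from `j` on, enumerated. -/
def natEquivIci (j : ℕ) : ℕ ≃ Set.Ici j where
  toFun m := ⟨m + j, Nat.le_add_left j m⟩
  invFun k := k - j
  left_inv m := by simp
  right_inv k := Subtype.ext (Nat.sub_add_cancel k.2)

/-- Up to a factor depending only on j, the terms are those of the exponential series at 1/B, so the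
sum is a tail of that series. -/
lemma hasSum_optTerm {δ : ℝ} (hδ0 : 0 ≤ δ) (hδ1 : δ < 1) (j : ℕ) :
    HasSum (fun k : Set.Ici (j + 1) => optTerm δ (j + 1) k)
      (j ! * ratioB δ ^ j / (Real.exp (1 / ratioB δ) - 1) * (Real.exp (1 / ratioB δ) -
        ∑ k ∈ Finset.range (j + 1), (1 / ratioB δ) ^ k / k !)) := by
  have hB : 0 < ratioB δ := div_pos (by linarith) (by linarith)
  have hE : Real.exp (1 / ratioB δ) - 1 ≠ 0 := by linarith [one_lt_exp_one_div_ratioB hδ0 hδ1]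
  rw [← (natEquivIci (j + 1)).hasSum_iff]
  have h : (fun k : Set.Ici (j + 1) => optTerm δ (j + 1) k) ∘ natEquivIci (j + 1) = fun m : ℕ =>
      j ! * ratioB δ ^ j / (Real.exp (1 / ratioB δ) - 1) *
        ((1 / ratioB δ) ^ (m + (j + 1)) / (m + (j + 1))!) := by
    funext m
    change ((j + 1 - 1)! : ℝ) / (ratioB δ ^ (m + (j + 1) - (j + 1) + 1) *
      (Real.exp (1 / ratioB δ) - 1) * ((m + (j + 1))! : ℝ)) = _
    rw [Nat.add_sub_cancel, Nat.add_sub_cancel, one_div_pow,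
      show ratioB δ ^ (m + (j + 1)) = ratioB δ ^ (m + 1) * ratioB δ ^ j by ring]
    field_simp
  rw [h]
  exact (hasSum_pow_div_factorial_nat_add (1 / ratioB δ) (j + 1)).mul_left _

lemma optUtility_succ {δ : ℝ} (hδ0 : 0 ≤ δ) (hδ1 : δ < 1) (j : ℕ) :
    optUtility δ (j + 1) =
      j ! * ratioB δ ^ j / (Real.exp (1 / ratioB δ) - 1) * (Real.exp (1 / ratioB δ) -
        ∑ k ∈ Finset.range (j + 1), (1 / ratioB δ) ^ k / k !) := by
  rw [optUtility, if_neg (Nat.succ_ne_zero j), (hasSum_optTerm hδ0 hδ1 j).tsum_eq]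

lemma hasSum_optUtility {δ : ℝ} (hδ0 : 0 ≤ δ) (hδ1 : δ < 1) {j : ℕ} (hj : 1 ≤ j) :
    HasSum (fun k : Set.Ici j => optTerm δ j k) (optUtility δ j) := by
  obtain ⟨j, rfl⟩ := Nat.exists_eq_add_of_le' hj
  rw [optUtility_succ hδ0 hδ1]
  exact hasSum_optTerm hδ0 hδ1 j

lemma optUtility_one {δ : ℝ} (hδ0 : 0 ≤ δ) (hδ1 : δ < 1) : optUtility δ 1 = 1 := by
  have hE : Real.exp (1 / ratioB δ) - 1 ≠ 0 := by linarith [one_lt_exp_one_div_ratioB hδ0 hδ1]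
  rw [← zero_add 1, optUtility_succ hδ0 hδ1]
  simpa using inv_mul_cancel₀ hE

lemma isUtilityDesign_optUtility {δ : ℝ} (hδ0 : 0 ≤ δ) (hδ1 : δ < 1) :
    IsUtilityDesign (optUtility δ) :=
  ⟨if_pos rfl, optUtility_one hδ0 hδ1⟩

lemma optUtility_nonneg {δ : ℝ} (hδ0 : 0 ≤ δ) (hδ1 : δ < 1) (j : ℕ) : 0 ≤ optUtility δ j := by
  rcases j with _ | j
  · exact (if_pos rfl).ge
  have hB : 0 < ratioB δ := div_pos (by linarith) (by linarith)
  have hE := one_lt_exp_one_div_ratioB hδ0 hδ1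
  rw [optUtility_succ hδ0 hδ1]
  refine mul_nonneg (div_nonneg (by positivity) (by linarith)) (sub_nonneg.2 ?_)
  exact Real.sum_le_exp_of_nonneg (by positivity) _

/-- Consecutive tails differ by one term, which the prefactor turns into a constant. That constant
is 1/q - 1, so the first family of games is tight at every k. -/
lemma optUtility_succ_eq {δ : ℝ} (hδ0 : 0 ≤ δ) (hδ1 : δ < 1) {k : ℕ} (hk : 1 ≤ k) :
    optUtility δ (k + 1) =
      ratioB δ * k * optUtility δ k - 1 / (Real.exp (1 / ratioB δ) - 1) := by
  obtain ⟨j, rfl⟩ := Nat.exists_eq_add_of_le' hk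
  have hB : 0 < ratioB δ := div_pos (by linarith) (by linarith)
  have hE : Real.exp (1 / ratioB δ) - 1 ≠ 0 := by linarith [one_lt_exp_one_div_ratioB hδ0 hδ1]
  rw [optUtility_succ hδ0 hδ1, optUtility_succ hδ0 hδ1, Finset.sum_range_succ _ (j + 1),
    Nat.factorial_succ, one_div_pow]
  generalize ∑ k ∈ Finset.range (j + 1), (1 / ratioB δ) ^ k / (k ! : ℝ) = S
  push_cast
  field_simp
  ring

/-- Termwise: with k = j + 1, the m-th terms of the two tails have ratio (j+1)/(m+j+2) < 1. -/
lemma optUtility_succ_le {δ : ℝ} (hδ0 : 0 ≤ δ) (hδ1 : δ < 1) {k : ℕ} (hk : 1 ≤ k) :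
    optUtility δ (k + 1) ≤ optUtility δ k := by
  obtain ⟨j, rfl⟩ := Nat.exists_eq_add_of_le' hk
  have hB : 0 < ratioB δ := div_pos (by linarith) (by linarith)
  have hE := one_lt_exp_one_div_ratioB hδ0 hδ1
  rw [optUtility_succ hδ0 hδ1, optUtility_succ hδ0 hδ1]
  refine hasSum_le (fun m => ?_)
    ((hasSum_pow_div_factorial_nat_add (1 / ratioB δ) (j + 1 + 1)).mul_left _)
    ((hasSum_pow_div_factorial_nat_add (1 / ratioB δ) (j + 1)).mul_left _)
  have hE' : 0 < Real.exp (1 / ratioB δ) - 1 := by linarith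
  rw [show m + (j + 1 + 1) = (m + (j + 1)) + 1 by ring, Nat.factorial_succ (m + (j + 1)),
    Nat.factorial_succ j, one_div_pow, one_div_pow, pow_succ (ratioB δ) (m + (j + 1)),
    pow_succ (ratioB δ) j]
  push_cast
  rw [← sub_nonneg]
  have : (j ! : ℝ) * ratioB δ ^ j / (Real.exp (1 / ratioB δ) - 1) *
        (1 / ratioB δ ^ (m + (j + 1)) / (m + (j + 1))!) -
      (j + 1 : ℝ) * j ! * (ratioB δ ^ j * ratioB δ) / (Real.exp (1 / ratioB δ) - 1) *
        (1 / (ratioB δ ^ (m + (j + 1)) * ratioB δ) / ((m + (j + 1) + 1) * (m + (j + 1))!)) =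
      (j ! : ℝ) * ratioB δ ^ j / (Real.exp (1 / ratioB δ) - 1) *
        (1 / ratioB δ ^ (m + (j + 1)) / (m + (j + 1))!) * ((m + 1) / (m + (j + 1) + 1)) := by
    field_simp
    ring
  rw [this]
  positivity

lemma optUtility_le_one {δ : ℝ} (hδ0 : 0 ≤ δ) (hδ1 : δ < 1) {k : ℕ} (hk : 1 ≤ k) :
    optUtility δ k ≤ 1 := by
  induction k, hk using Nat.le_induction with
  | base => exact (optUtility_one hδ0 hδ1).le
  | succ k hk ih => exact (optUtility_succ_le hδ0 hδ1 hk).trans ih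

/-! ### Lower bound for the optimal design -/

/-- The inequality, one resource at a time, between the welfare of two allocations: `x` and `z`
agents select the resource in the first and in the second one, `A` of them only in the first and
`C` only in the second. -/
lemma coverWelfare_le_of_recurrence {B ρ : ℝ} {u : ℕ → ℝ} (hB : 1 ≤ B) (hρ : 1 ≤ ρ)
    (hu0 : ∀ k, 0 ≤ u k) (hu1 : u 1 = 1) (hle : ∀ k, 1 ≤ k → u k ≤ 1)
    (hanti : ∀ k, 1 ≤ k → u (k + 1) ≤ u k)
    (hrec : ∀ k : ℕ, 1 ≤ k → u (k + 1) = B * k * u k - (ρ - 1)) {A C x z : ℕ} (hA : A ≤ x)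
    (hz : z + A = x + C) :
    coverWelfare z + (B * (A * u x) - C * u (x + 1)) ≤ ρ * coverWelfare x := by
  have hz1 : coverWelfare z ≤ 1 := by unfold coverWelfare; split_ifs <;> norm_num
  rcases Nat.eq_zero_or_pos x with rfl | hx
  · obtain rfl : A = 0 := by omega
    obtain rfl : z = C := by omega
    rcases Nat.eq_zero_or_pos z with rfl | hz0
    · simp [coverWelfare]
    · have : (1 : ℝ) ≤ z := by exact_mod_cast hz0
      simp [hu1, coverWelfare]
      split_ifs <;> linarith
  · have hux := hu0 x
    have hux1 := hu0 (x + 1)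
    rw [show coverWelfare x = 1 from if_neg hx.ne', mul_one]
    have hr := hrec x hx
    have hC : 0 ≤ C * u (x + 1) := by positivity
    -- If A < x, at least one B u(x) is missing from B x u(x) = u(x+1) + ρ - 1, and B u(x) ≥ u(x+1),
    -- so ρ - 1 remains. If A = x, then z = C: either z = 0 and u(x+1) ≤ 1 suffices, or the C term
    -- cancels u(x+1).
    rcases Nat.lt_or_ge A x with hAx | hAx
    · have h1 : (A : ℝ) + 1 ≤ x := by exact_mod_cast hAx
      have h2 : B * (A * u x) + B * u x ≤ B * x * u x := by
        nlinarith [mul_nonneg (by linarith : 0 ≤ B) hux]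
      have h3 := hanti x hx
      nlinarith
    · obtain rfl : A = x := le_antisymm hA hAx
      obtain rfl : z = C := by omega
      rcases Nat.eq_zero_or_pos z with rfl | hz0
      · have := hle (A + 1) (by omega)
        simp [coverWelfare]
        linarith
      · have : (1 : ℝ) ≤ z := by exact_mod_cast hz0
        nlinarith

/-- Nonemptiness matters because the infimum of the empty set is `0` by convention. -/
lemma one_sub_exp_neg_le_classPoA {δ : ℝ} (hδ0 : 0 ≤ δ) (hδ1 : δ < 1) {N : ℕ∞}
    (hne : (gameClass N coverWelfare (optUtility δ) δ).Nonempty) :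
    1 - Real.exp (-(1 / ratioB δ)) ≤ classPoA N coverWelfare (optUtility δ) δ := by
  have hE := one_lt_exp_one_div_ratioB hδ0 hδ1
  have hE' : Real.exp (1 / ratioB δ) - 1 ≠ 0 := by linarith
  have hq : 0 < 1 - Real.exp (-(1 / ratioB δ)) := by
    rw [Real.exp_neg, sub_pos]
    exact inv_lt_one_of_one_lt₀ hE
  refine le_csInf (hne.image _) ?_
  rintro _ ⟨G, ⟨-, hG, he, hpos⟩, rfl⟩
  refine G.le_poa hq he hpos fun a ha b hb => ?_
  obtain ⟨ρ, hρ⟩ : ∃ ρ, ρ = 1 + 1 / (Real.exp (1 / ratioB δ) - 1) := ⟨_, rfl⟩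
  have hρ1 : 1 ≤ ρ := by
    rw [hρ]
    have := one_div_pos.2 (sub_pos.2 hE)
    linarith
  have hqρ : (1 - Real.exp (-(1 / ratioB δ))) * ρ = 1 := by
    rw [hρ, Real.exp_neg]
    field_simp
    ring
  have hdev := G.sum_deviation_nonneg hG (optUtility_nonneg hδ0 hδ1) ha hb
  have hle : G.welfare coverWelfare b ≤ ρ * G.welfare coverWelfare a := by
    have h1δ : 0 < 1 - δ := by linarith
    have hB : (1 - δ) * ratioB δ = 1 + δ := mul_div_cancel₀ _ h1δ.ne'
    -- Dividing the summed equilibrium conditions by 1 - δ leaves B as the only trace of the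
    -- uncertainty.
    rw [← hB] at hdev
    simp only [mul_assoc (1 - δ), ← mul_sub, mul_left_comm _ (1 - δ)] at hdev
    rw [← Finset.mul_sum] at hdev
    have hdev' := nonneg_of_mul_nonneg_right hdev h1δ
    refine (le_add_of_nonneg_right hdev').trans ?_
    unfold Game.welfare
    rw [← Finset.sum_add_distrib, Finset.mul_sum]
    refine Finset.sum_le_sum fun r _ => ?_
    rw [← mul_add, mul_left_comm ρ]
    refine mul_le_mul_of_nonneg_left ?_ (G.trueState_nonneg r)
    refine coverWelfare_le_of_recurrence (B := ratioB δ)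
      (by unfold ratioB; rw [le_div_iff₀ h1δ]; linarith) hρ1 (optUtility_nonneg hδ0 hδ1)
      (optUtility_one hδ0 hδ1) (fun k => optUtility_le_one hδ0 hδ1)
      (fun k => optUtility_succ_le hδ0 hδ1)
      (fun k hk => by rw [optUtility_succ_eq hδ0 hδ1 hk, hρ]; ring)
      (Finset.card_le_card (Finset.monotone_filter_right _ fun i _ h => h.1)) ?_
    unfold Game.load
    simp only [Finset.card_filter]
    rw [← Finset.sum_add_distrib, ← Finset.sum_add_distrib]
    refine Finset.sum_congr rfl fun i _ => ?_
    by_cases h1 : r ∈ a i <;> by_cases h2 : r ∈ b i <;> simp [h1, h2]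
  calc (1 - Real.exp (-(1 / ratioB δ))) * G.welfare coverWelfare b
      ≤ (1 - Real.exp (-(1 / ratioB δ))) * (ρ * G.welfare coverWelfare a) :=
        mul_le_mul_of_nonneg_left hle hq.le
    _ = G.welfare coverWelfare a := by rw [← mul_assoc, hqρ, one_mul]

/-! ### Combining the two families of games -/

lemma classPoA_le_one {δ : ℝ} (hδ0 : 0 ≤ δ) (hδ1 : δ < 1) {u : ℕ → ℝ} {N : ℕ∞} (hu : u 1 = 1)
    (hN : 1 ≤ N) : classPoA N coverWelfare u δ ≤ 1 := by
  have h := classPoA_mul_le_of_le hδ0 hδ1 (k := 1) hu (by simpa using hN)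
  rw [hu, Nat.cast_one, mul_one, mul_one] at h
  have hB := one_le_ratioB hδ0 hδ1
  nlinarith [classPoA_nonneg N u δ]

/-- The recurrence of the first family of games, solved. -/
lemma le_classPoA_mul {δ : ℝ} (hδ0 : 0 ≤ δ) (hδ1 : δ < 1) {u : ℕ → ℝ} {N : ℕ∞} (hu : u 1 = 1)
    (n : ℕ) (hn : ((n + 1 : ℕ) : ℕ∞) ≤ N) :
    (1 - (1 - classPoA N coverWelfare u δ) *
      ∑ k ∈ Finset.range (n + 1), (1 / ratioB δ) ^ k / k !) * (ratioB δ ^ n * n !) ≤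
      classPoA N coverWelfare u δ * u (n + 1) := by
  have hB : 0 < ratioB δ := by linarith [one_le_ratioB hδ0 hδ1]
  have hp : classPoA N coverWelfare u δ ≤ 1 :=
    classPoA_le_one hδ0 hδ1 hu (le_trans (by simp) hn)
  induction n with
  | zero => simp [hu]
  | succ n ih =>
    have ih := ih (le_trans (by exact_mod_cast Nat.le_succ _) hn)
    -- At k = n + 1 this reads p u(n+2) ≥ B (n+1) p u(n+1) - (1-p), the recurrence that `h2`
    -- exhibits as an equality for the left-hand sides.
    have h := classPoA_mul_le_of_succ_le hδ0 hδ1 hu (Nat.le_add_left 1 n) hn hp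
    rw [Finset.sum_range_succ _ (n + 1), Nat.factorial_succ, one_div_pow, pow_succ]
    generalize classPoA N coverWelfare u δ = p at *
    generalize ∑ k ∈ Finset.range (n + 1), (1 / ratioB δ) ^ k / (k ! : ℝ) = S at *
    have h2 : (1 - (1 - p) * (S + 1 / (ratioB δ ^ n * ratioB δ) / ((n + 1) * (n ! : ℝ)))) *
        (ratioB δ ^ n * ratioB δ * ((n + 1) * (n ! : ℝ))) =
        ratioB δ * (n + 1) * ((1 - (1 - p) * S) * (ratioB δ ^ n * n !)) - (1 - p) := by
      field_simp
      ring
    push_cast at h ⊢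
    rw [h2]
    have h3 := mul_le_mul_of_nonneg_left ih (by positivity : 0 ≤ ratioB δ * (n + 1))
    linarith

/-- No design does better than `1 - exp (-1 / B)` by more than `1 / n`, once there are `n`
agents. -/
lemma classPoA_le_add_one_div {δ : ℝ} (hδ0 : 0 ≤ δ) (hδ1 : δ < 1) {u : ℕ → ℝ} {N : ℕ∞}
    (hu : u 1 = 1) {n : ℕ} (hn0 : 1 ≤ n) (hn : (n : ℕ∞) ≤ N) :
    classPoA N coverWelfare u δ ≤ 1 - Real.exp (-(1 / ratioB δ)) + 1 / n := by
  obtain ⟨n, rfl⟩ := Nat.exists_eq_add_of_le' hn0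
  have hB1 := one_le_ratioB hδ0 hδ1
  have hB : 0 < ratioB δ := by linarith
  have hp : classPoA N coverWelfare u δ ≤ 1 :=
    classPoA_le_one hδ0 hδ1 hu (le_trans (by simp) hn)
  have h1 := le_classPoA_mul hδ0 hδ1 hu n hn
  have h2 := classPoA_mul_le_of_le hδ0 hδ1 hu hn
  have hS := Real.sum_le_exp_of_nonneg (x := 1 / ratioB δ) (by positivity) (n + 1)
  have hE := one_lt_exp_one_div_ratioB hδ0 hδ1
  rw [Real.exp_neg]
  generalize classPoA N coverWelfare u δ = p at *
  generalize ∑ k ∈ Finset.range (n + 1), (1 / ratioB δ) ^ k / (k ! : ℝ) = S at *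
  generalize Real.exp (1 / ratioB δ) = E at *
  have hn1 : (0 : ℝ) < ((n + 1 : ℕ) : ℝ) := by positivity
  -- The lower bound for p u(n+1) meets the upper bound 1/(B(n+1)). Discarding B ≥ 1 needs p u(n+1)
  -- ≥ 0, hence the case split.
  have h3 : (1 - (1 - p) * S) * (ratioB δ ^ n * n !) * (n + 1 : ℕ) ≤ 1 := by
    by_cases hs : 1 - (1 - p) * S ≤ 0
    · exact (mul_nonpos_of_nonpos_of_nonneg
        (mul_nonpos_of_nonpos_of_nonneg hs (by positivity)) hn1.le).trans zero_le_one
    · have hs' : 0 ≤ (1 - (1 - p) * S) * (ratioB δ ^ n * n !) :=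
        mul_nonneg (not_le.1 hs).le (by positivity)
      have h4 : p * u (n + 1) * (n + 1 : ℕ) ≤ ratioB δ * (p * u (n + 1) * (n + 1 : ℕ)) :=
        le_mul_of_one_le_left (mul_nonneg (hs'.trans h1) hn1.le) hB1
      have h5 := mul_le_mul_of_nonneg_right h1 hn1.le
      linarith
  have h6 : 1 - (1 - p) * E ≤ 1 / ((n + 1 : ℕ) : ℝ) := by
    have h7 : (1 - p) * S ≤ (1 - p) * E := mul_le_mul_of_nonneg_left hS (by linarith)
    have h8 : 1 - (1 - p) * S ≤ 1 / ((n + 1 : ℕ) : ℝ) := by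
      by_cases hs : 1 - (1 - p) * S ≤ 0
      · exact hs.trans (by positivity)
      · rw [le_div_iff₀ hn1]
        refine le_trans (mul_le_mul_of_nonneg_right ?_ hn1.le) h3
        refine le_mul_of_one_le_right (not_le.1 hs).le ?_
        exact one_le_mul_of_one_le_of_one_le (one_le_pow₀ hB1)
          (by exact_mod_cast Nat.one_le_iff_ne_zero.2 (Nat.factorial_ne_zero n))
    linarith
  have hE0 : 0 < E := by linarith
  have h9 : (p - 1 + E⁻¹) * E ≤ 1 / ((n + 1 : ℕ) : ℝ) := by
    rw [add_mul, inv_mul_cancel₀ hE0.ne']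
    linarith
  by_cases hs : p - 1 + E⁻¹ ≤ 0
  · have : 0 < 1 / ((n + 1 : ℕ) : ℝ) := by positivity
    linarith
  · have : p - 1 + E⁻¹ ≤ (p - 1 + E⁻¹) * E := le_mul_of_one_le_right (not_le.1 hs).le hE.le
    linarith

lemma classPoA_top_le {δ : ℝ} (hδ0 : 0 ≤ δ) (hδ1 : δ < 1) {u : ℕ → ℝ} (hu : u 1 = 1) :
    classPoA ⊤ coverWelfare u δ ≤ 1 - Real.exp (-(1 / ratioB δ)) := by
  refine le_of_forall_pos_le_add fun ε hε => ?_
  obtain ⟨n, hn⟩ := exists_nat_one_div_lt hε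
  have := classPoA_le_add_one_div hδ0 hδ1 (N := ⊤) hu (Nat.le_add_left 1 n) le_top
  push_cast at this
  linarith

/-- One agent and one resource that the agent has to select. -/
lemma gameClass_nonempty {δ : ℝ} (hδ0 : 0 ≤ δ) (u : ℕ → ℝ) {N : ℕ∞} (hN : 1 ≤ N) :
    (gameClass N coverWelfare u δ).Nonempty := by
  let G : Game :=
    { agents := 1
      resources := 1
      actions := fun _ => {Finset.univ}
      trueState := fun _ => 1
      belief := fun _ _ => 1
      trueState_nonneg := fun _ => zero_le_one
      belief_nonneg := fun _ _ => zero_le_one }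
  have ha : (fun _ => Finset.univ : G.Profile) ∈ G.allocations :=
    fun i => Finset.mem_singleton_self _
  refine ⟨G, by simpa [G] using hN, fun i r => by simpa [G] using hδ0, ⟨_, ha, ?_⟩, _, ha, ?_⟩
  · intro i s hs
    obtain rfl : s = Finset.univ := Finset.mem_singleton.1 hs
    rw [Function.update_eq_self_iff.2 rfl]
  · simp [Game.welfare, Game.load, coverWelfare, G]

/-! ### Optimal value and uniqueness -/

lemma classPoA_top_optUtility {δ : ℝ} (hδ0 : 0 ≤ δ) (hδ1 : δ < 1) :
    classPoA ⊤ coverWelfare (optUtility δ) δ = 1 - Real.exp (-(1 / ratioB δ)) :=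
  le_antisymm (classPoA_top_le hδ0 hδ1 (optUtility_one hδ0 hδ1))
    (one_sub_exp_neg_le_classPoA hδ0 hδ1 (gameClass_nonempty hδ0 _ le_top))

lemma eq_optUtility_of_classPoA_top_eq {δ : ℝ} (hδ0 : 0 ≤ δ) (hδ1 : δ < 1) {u : ℕ → ℝ}
    (hu : IsUtilityDesign u)
    (h : classPoA ⊤ coverWelfare u δ = 1 - Real.exp (-(1 / ratioB δ))) : u = optUtility δ := by
  have hB1 := one_le_ratioB hδ0 hδ1
  have hE := one_lt_exp_one_div_ratioB hδ0 hδ1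
  obtain ⟨q, hq⟩ : ∃ q, q = 1 - Real.exp (-(1 / ratioB δ)) := ⟨_, rfl⟩
  have hq0 : 0 < q := by
    rw [hq, Real.exp_neg, sub_pos]
    exact inv_lt_one_of_one_lt₀ hE
  have hqE : 1 / q = 1 + 1 / (Real.exp (1 / ratioB δ) - 1) := by
    have : Real.exp (1 / ratioB δ) - 1 ≠ 0 := by linarith
    rw [div_eq_iff hq0.ne', hq, Real.exp_neg]
    field_simp
    ring
  obtain ⟨d, hd⟩ : ∃ d : ℕ → ℝ, d = fun k => u k - optUtility δ k := ⟨_, rfl⟩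
  have hd1 : d 1 = 0 := by rw [hd]; simp [hu.2, optUtility_one hδ0 hδ1]
  have hstep : ∀ k : ℕ, 1 ≤ k → ratioB δ * k * d k ≤ d (k + 1) := by
    intro k hk
    have h1 := classPoA_mul_le_of_succ_le hδ0 hδ1 (N := ⊤) hu.2 hk le_top
      (classPoA_le_one hδ0 hδ1 hu.2 le_top)
    rw [h, ← hq, ← le_div_iff₀' hq0, hqE] at h1
    have h2 := optUtility_succ_eq hδ0 hδ1 hk
    simp only [hd]
    linarith
  have hd0 : ∀ k, 1 ≤ k → 0 ≤ d k := by
    intro k hk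
    induction k, hk using Nat.le_induction with
    | base => exact hd1.ge
    | succ k hk ih => exact le_trans (by positivity) (hstep k hk)
  have hstep' : ∀ k : ℕ, 1 ≤ k → k * d k ≤ d (k + 1) := by
    intro k hk
    have := mul_nonneg (Nat.cast_nonneg (α := ℝ) k) (hd0 k hk)
    nlinarith [hstep k hk]
  -- Since the optimal design is nonnegative, d(k) ≤ u(k), and the second family bounds B k u(k) by
  -- 1/q.
  have hbdd : ∀ k : ℕ, 1 ≤ k → k * d k ≤ 1 / q := by
    intro k hk
    have h1 := classPoA_mul_le_of_le hδ0 hδ1 (N := ⊤) (k := k) hu.2 le_top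
    rw [h, ← hq, ← le_div_iff₀' hq0] at h1
    refine le_trans ?_ h1
    have h2 := optUtility_nonneg hδ0 hδ1 k
    have h3 := hd0 k hk
    have h4 : d k ≤ u k := by rw [hd]; simpa using h2
    have h5 : (k : ℝ) * d k ≤ k * u k := mul_le_mul_of_nonneg_left h4 (Nat.cast_nonneg k)
    have h6 : 0 ≤ (k : ℝ) * u k := mul_nonneg (Nat.cast_nonneg k) (h3.trans h4)
    nlinarith
  ext k
  rcases Nat.eq_zero_or_pos k with rfl | hk
  · rw [hu.1, optUtility, if_pos rfl]
  by_contra hne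
  have hpos : 0 < d k := lt_of_le_of_ne (hd0 k hk) fun h0 => hne (by
    rw [hd] at h0
    linarith)
  have hmono : ∀ m, k ≤ m → d k ≤ d m := by
    intro m hm
    induction m, hm using Nat.le_induction with
    | base => exact le_rfl
    | succ m hm ih =>
      have h1 : (1 : ℝ) ≤ m := by exact_mod_cast hk.trans_le hm
      exact ih.trans ((le_mul_of_one_le_left (hd0 m (by omega)) h1).trans (hstep' m (by omega)))
  -- From k on d does not decrease, so (m+k) d(m+k) ≥ m d(k) > 1/q.
  obtain ⟨m, hm⟩ := exists_nat_gt (1 / q / d k)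
  rw [div_lt_iff₀ hpos] at hm
  have h1 := hbdd (m + k) (by omega)
  have h2 := hmono (m + k) (by omega)
  have h3 : (m : ℝ) * d k ≤ ((m + k : ℕ) : ℝ) * d (m + k) := by
    gcongr
    omega
  linarith

lemma tendsto_const_add_one_div (q : ℝ) : Tendsto (fun n : ℕ => q + 1 / (n : ℝ)) atTop (𝓝 q) := by
  simpa using tendsto_const_nhds.add (tendsto_one_div_atTop_nhds_zero_nat (𝕜 := ℝ))

end CoveringUncertainty

theorem theorem2 (δ : ℝ) (hδ0 : 0 ≤ δ) (hδ1 : δ < 1) :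
    -- the series that defines the design converges, and the design is admissible
    (∀ j : ℕ, 1 ≤ j →
      HasSum (fun k : Set.Ici j => CoveringUncertainty.optTerm δ j k)
        (CoveringUncertainty.optUtility δ j)) ∧
    CoveringUncertainty.IsUtilityDesign (CoveringUncertainty.optUtility δ) ∧
    -- it maximizes the price of anarchy of the class of set covering games
    (∀ u : ℕ → ℝ, CoveringUncertainty.IsUtilityDesign u →
      CoveringUncertainty.classPoA ⊤ CoveringUncertainty.coverWelfare u δ ≤
        CoveringUncertainty.classPoA ⊤ CoveringUncertainty.coverWelfare
          (CoveringUncertainty.optUtility δ) δ) ∧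
    -- and is the only design that does
    (∀ u : ℕ → ℝ, CoveringUncertainty.IsUtilityDesign u →
      CoveringUncertainty.classPoA ⊤ CoveringUncertainty.coverWelfare u δ =
        CoveringUncertainty.classPoA ⊤ CoveringUncertainty.coverWelfare
          (CoveringUncertainty.optUtility δ) δ →
      u = CoveringUncertainty.optUtility δ) ∧
    -- the optimal price of anarchy
    CoveringUncertainty.classPoA ⊤ CoveringUncertainty.coverWelfare
        (CoveringUncertainty.optUtility δ) δ =
      1 - Real.exp (-(1 / CoveringUncertainty.ratioB δ)) ∧
    -- it is also the limit, as the bound on the number of agents tends to infinity, of the price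
    -- of anarchy of this design and of the best price of anarchy that any design achieves
    Tendsto
      (fun n : ℕ => CoveringUncertainty.classPoA n CoveringUncertainty.coverWelfare
        (CoveringUncertainty.optUtility δ) δ)
      atTop (𝓝 (1 - Real.exp (-(1 / CoveringUncertainty.ratioB δ)))) ∧
    Tendsto
      (fun n : ℕ => ⨆ u : {u : ℕ → ℝ // CoveringUncertainty.IsUtilityDesign u},
        CoveringUncertainty.classPoA n CoveringUncertainty.coverWelfare u δ)
      atTop (𝓝 (1 - Real.exp (-(1 / CoveringUncertainty.ratioB δ)))) := by
  have hopt := CoveringUncertainty.classPoA_top_optUtility hδ0 hδ1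
  have hdesign := CoveringUncertainty.isUtilityDesign_optUtility hδ0 hδ1
  have hlower : ∀ n : ℕ, 1 ≤ n → 1 - Real.exp (-(1 / CoveringUncertainty.ratioB δ)) ≤
      CoveringUncertainty.classPoA n CoveringUncertainty.coverWelfare
        (CoveringUncertainty.optUtility δ) δ := fun n hn =>
    CoveringUncertainty.one_sub_exp_neg_le_classPoA hδ0 hδ1
      (CoveringUncertainty.gameClass_nonempty hδ0 _ (by exact_mod_cast hn))
  have hlim := CoveringUncertainty.tendsto_const_add_one_div
    (1 - Real.exp (-(1 / CoveringUncertainty.ratioB δ)))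
  refine ⟨fun j => CoveringUncertainty.hasSum_optUtility hδ0 hδ1, hdesign, fun u hu => ?_,
    fun u hu h => ?_, hopt, ?_, ?_⟩
  · rw [hopt]
    exact CoveringUncertainty.classPoA_top_le hδ0 hδ1 hu.2
  · exact CoveringUncertainty.eq_optUtility_of_classPoA_top_eq hδ0 hδ1 hu (h.trans hopt)
  · refine tendsto_of_tendsto_of_tendsto_of_le_of_le' tendsto_const_nhds hlim ?_ ?_
    -- Without agents no welfare is positive: at n = 0 the class is empty, its infimum is `0`, and
    -- the lower bound fails.
    · filter_upwards [eventually_ge_atTop 1] with n hn using hlower n hn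
    · filter_upwards [eventually_ge_atTop 1] with n hn
      exact CoveringUncertainty.classPoA_le_add_one_div hδ0 hδ1 hdesign.2 hn le_rfl
  · have : Nonempty {u : ℕ → ℝ // CoveringUncertainty.IsUtilityDesign u} := ⟨⟨_, hdesign⟩⟩
    refine tendsto_of_tendsto_of_tendsto_of_le_of_le' tendsto_const_nhds hlim ?_ ?_
    · filter_upwards [eventually_ge_atTop 1] with n hn
      refine (hlower n hn).trans (le_ciSup
        (f := fun u : {u : ℕ → ℝ // CoveringUncertainty.IsUtilityDesign u} =>
          CoveringUncertainty.classPoA n CoveringUncertainty.coverWelfare u δ)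
        -- The real supremum needs an upper bound uniform in the design; 1 serves.
        ⟨1, ?_⟩ ⟨_, hdesign⟩)
      rintro _ ⟨u, rfl⟩
      exact CoveringUncertainty.classPoA_le_one hδ0 hδ1 u.2.2 (by exact_mod_cast hn)
    · filter_upwards [eventually_ge_atTop 1] with n hn
      exact ciSup_le fun u =>
        CoveringUncertainty.classPoA_le_add_one_div hδ0 hδ1 u.2.2 hn le_rfl
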